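/- Let $L$ be a finite set and $r\in\mathbb{N}$. An $L$-digraph is a directed graph whose edge set $E$ is a subset of $V\times V$, where every edge carries one label from $L$ so that, at each vertex, distinct outgoing edges have distinct labels and distinct incoming edges have distinct labels. All graphs $G$, $H$ below are finite. Distance, connectedness and girth refer to the underlying undirected graph; the degree of a vertex is the number of outgoing plus the number of incoming edges. The $r$-neighbourhood of a vertex $u$ in an $L$-digraph with a linearly ordered vertex set is the rooted ordered $L$-digraph, with root $u$, induced on the set of vertices at distance at most $r$ from $u$. A lift of $G$ is an $L$-digraph $C$ with a covering map $C\to G$, that is, a surjective homomorphism preserving edge directions, edge labels, in-degrees and out-degrees. Let $T^*$ be the complete $L$-labelled directed tree of radius $r$, whose vertices are the reduced words of length at most $r$ in the letters $L\cup L^{-1}$, rooted at the empty word $\lambda$, where the outgoing edge labelled $\ell$ leads from a word $w$ to the reduced form of $w\ell$. Theorem. There is a linear order $<^*$ on the vertices of $T^*$ (depending only on $L$ and $r$) such that, writing $\tau^*=(T^*,<^*,\lambda)$, for every $\varepsilon>0$ there is a finite ordered $L$-digraph $(H_\varepsilon,<_\varepsilon)$ with the following properties. (a) $H_\varepsilon$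 is connected, is $2|L|$-regular, has no self-loops and no pairs of opposite edges, and has girth larger than $2r+1$; and at least a $(1-\varepsilon)$ fraction of the vertices of $(H_\varepsilon,<_\varepsilon)$ have $r$-neighbourhoods isomorphic to $\tau^*$. (b) For every finite $L$-digraph $G$, let $H_\varepsilon\times_L G$ be the $L$-digraph on $V(H_\varepsilon)\times V(G)$ that has an edge from $(h,g)$ to $(h',g')$ labelled $\ell$ exactly when $H_\varepsilon$ has an edge $(h,h')$ labelled $\ell$ and $G$ has an edge $(g,g')$ labelled $\ell$. Then the projection $(h,g)\mapsto g$ is a covering map, so that $G_\varepsilon = H_\varepsilon\times_L G$ is a lift of $G$, and $G_\varepsilon$ has a linear order for which at least a $(1-\varepsilon)$ fraction of its vertices have $r$-neighbourhoods isomorphic to a subtree of $\tau^*$ containing the root $\lambda$ (isomorphisms preserve root, directed labelled edges and order). (c) If moreover $G$ is connected, then the lift can be taken connected: some connected component of $H_\varepsilon\times_L G$ is, with the same projection, a lift of $G$, and it has a linear order for which at least a $(1-\varepsilon)$ fraction of its vertices have $r$-neighbourhoods isomorphic to a subtree of $\tau^*$ containing the root $\lambda$. -/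

import Mathlib

universe u v w

/-- An `L`-digraph on the vertex set `V`: a directed graph whose edge set is a subset of `V × V`,
every edge carrying exactly one label in `L`, such that the labelling is proper.
`edge a x y` says that `(x, y)` is an edge and that its label is `a`. -/
@[ext]
structure LDigraph (L : Type u) (V : Type v) where
  edge : L → V → V → Prop
  label_unique : ∀ a b x y, edge a x y → edge b x y → a = b
  out_proper : ∀ a x y z, edge a x y → edge a x z → y = z
  in_proper : ∀ a x y z, edge a y x → edge a z x → y = z

namespace LDigraph

variable {L : Type u} {V : Type v} {W : Type w}

/-- The underlying undirected graph (orientations, labels and self-loops forgotten). -/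
def toSimpleGraph (G : LDigraph L V) : SimpleGraph V :=
  SimpleGraph.fromRel fun x y => ∃ a, G.edge a x y

/-- Connectedness, edges being traversable in both directions. In particular `V` is nonempty. -/
def Connected (G : LDigraph L V) : Prop := G.toSimpleGraph.Connected

/-- The number of edges leaving `x`. -/
noncomputable def outDegree (G : LDigraph L V) (x : V) : ℕ := {y | ∃ a, G.edge a x y}.ncard

/-- The number of edges entering `x`. -/
noncomputable def inDegree (G : LDigraph L V) (x : V) : ℕ := {y | ∃ a, G.edge a y x}.ncard

/-- Every vertex is incident to exactly `d` edges, counting incoming and outgoing ones. -/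
def IsRegular (G : LDigraph L V) (d : ℕ) : Prop := ∀ x, G.outDegree x + G.inDegree x = d

/-- `G` is an orientation of a simple graph: there is no self-loop (case `x = y`) and no pair of
opposite edges. -/
def IsOriented (G : LDigraph L V) : Prop := ∀ a b x y, G.edge a x y → ¬ G.edge b y x

/-- The induced `L`-digraph on a set of vertices. -/
def induce (G : LDigraph L V) (S : Set V) : LDigraph L S where
  edge a x y := G.edge a x y
  label_unique a b x y := G.label_unique a b x y
  out_proper a _ _ _ h h' := Subtype.ext (G.out_proper a _ _ _ h h')
  in_proper a _ _ _ h h' := Subtype.ext (G.in_proper a _ _ _ h h')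

/-- The product of two `L`-digraphs obtained by matching equi-labelled edges. -/
def product (H : LDigraph L W) (G : LDigraph L V) : LDigraph L (W × V) where
  edge a x y := H.edge a x.1 y.1 ∧ G.edge a x.2 y.2
  label_unique a b x y h h' := H.label_unique a b x.1 y.1 h.1 h'.1
  out_proper a _ _ _ h h' :=
    Prod.ext (H.out_proper a _ _ _ h.1 h'.1) (G.out_proper a _ _ _ h.2 h'.2)
  in_proper a _ _ _ h h' :=
    Prod.ext (H.in_proper a _ _ _ h.1 h'.1) (G.in_proper a _ _ _ h.2 h'.2)

/-- `φ` is a covering map from `C` onto `G`, that is, `C` is a lift of `G` through `φ`: a surjective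
homomorphism that preserves edge directions, edge labels and vertex degrees. -/
structure IsCoveringMap (C : LDigraph L W) (G : LDigraph L V) (φ : W → V) : Prop where
  surjective : Function.Surjective φ
  map_edge : ∀ a x y, C.edge a x y → G.edge a (φ x) (φ y)
  outDegree_eq : ∀ x, C.outDegree x = G.outDegree (φ x)
  inDegree_eq : ∀ x, C.inDegree x = G.inDegree (φ x)

/-- The set of vertices at distance at most `r` from `x`, the distance being `⊤` between vertices
that are not joined by a path. -/
def ball (G : LDigraph L V) (r : ℕ) (x : V) : Set V := {y | G.toSimpleGraph.edist x y ≤ r}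

/-- For `x ∈ S` and `x' ∈ S'`: the rooted ordered `L`-digraph `(G, <, x)` restricted to `S` is
isomorphic to `(G', <', x')` restricted to `S'`. -/
def RestrictIso (G : LDigraph L V) (o : LinearOrder V) (x : V) (S : Set V)
    (G' : LDigraph L W) (o' : LinearOrder W) (x' : W) (S' : Set W) : Prop :=
  ∃ f : S ≃ S',
    (∀ y : S, (y : V) = x ↔ (f y : W) = x') ∧
    (∀ (a : L) (y z : S), G.edge a y z ↔ G'.edge a (f y) (f z)) ∧
    (∀ y z : S, o.lt y z ↔ o'.lt (f y) (f z))

end LDigraph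

/-- The vertices of the complete `L`-labelled rooted directed tree of radius `r`: the reduced words
of length at most `r` in the letters `ℓ, ℓ⁻¹` (`ℓ ∈ L`). An element of `FreeGroup L` is a reduced
word, and `FreeGroup.norm` is its length. -/
def TreeVertex (L : Type u) [DecidableEq L] (r : ℕ) : Type u :=
  {g : FreeGroup L // g.norm ≤ r}

namespace TreeVertex

variable (L : Type u) [DecidableEq L] (r : ℕ)

/-- The root, i.e. the empty word. -/
def root : TreeVertex L r := ⟨1, by simp⟩

/-- The complete `L`-labelled directed tree of radius `r`: an edge labelled `ℓ` leads from a word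
`g` to the reduced form of `gℓ`, whenever both have length at most `r`. -/
def tree : LDigraph L (TreeVertex L r) where
  edge a g h := h.1 = g.1 * FreeGroup.of a
  label_unique _ _ _ _ hab hab' :=
    FreeGroup.of_injective (mul_left_cancel (hab.symm.trans hab'))
  out_proper _ _ _ _ h₁ h₂ := Subtype.ext (h₁.trans h₂.symm)
  in_proper _ _ _ _ h₁ h₂ := Subtype.ext (mul_right_cancel (h₁.symm.trans h₂))

variable {L r}

/-- `S` is the vertex set of a subtree of the complete tree that contains the root. -/
def IsSubtree (S : Set (TreeVertex L r)) : Prop :=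
  root L r ∈ S ∧ ((tree L r).induce S).Connected

end TreeVertex

namespace LDigraph

variable {L : Type u} [DecidableEq L] {V : Type v} {r : ℕ}

/-- The vertices of the ordered `L`-digraph `(G, <)` whose ordered `r`-neighbourhood is isomorphic
to the ordered complete tree `(T*, <*, λ)`. -/
def typeVertices (G : LDigraph L V) (o : LinearOrder V)
    (oStar : LinearOrder (TreeVertex L r)) : Set V :=
  {x | G.RestrictIso o x (G.ball r x)
    (TreeVertex.tree L r) oStar (TreeVertex.root L r) Set.univ}

/-- The vertices of the ordered `L`-digraph `(G, <)` whose ordered `r`-neighbourhood is isomorphic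
to a subtree of the ordered complete tree `(T*, <*, λ)`. -/
def subtreeVertices (G : LDigraph L V) (o : LinearOrder V)
    (oStar : LinearOrder (TreeVertex L r)) : Set V :=
  {x | ∃ S : Set (TreeVertex L r), TreeVertex.IsSubtree S ∧
    G.RestrictIso o x (G.ball r x)
      (TreeVertex.tree L r) oStar (TreeVertex.root L r) S}

/-- `U` contains at least a fraction `α` of the elements of the (finite) set `V`. -/
def HasFraction (U : Set V) (α : ℝ) : Prop := α * (Nat.card V : ℝ) ≤ (U.ncard : ℝ)

/-- `(H, <)` is a connected `2|L|`-regular `L`-digraph (without self-loops and opposite edges) of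
girth larger than `2r + 1` in which at least a fraction `1 - ε` of the vertices have an ordered
`r`-neighbourhood isomorphic to the ordered complete tree `(T*, <*, λ)`. -/
structure IsHomogeneous (H : LDigraph L V) (o : LinearOrder V)
    (oStar : LinearOrder (TreeVertex L r)) (ε : ℝ) : Prop where
  connected : H.Connected
  oriented : H.IsOriented
  regular : H.IsRegular (2 * Nat.card L)
  girth : ((2 * r + 1 : ℕ) : ℕ∞) < H.toSimpleGraph.egirth
  homogeneous : HasFraction (H.typeVertices o oStar) (1 - ε)

end LDigraph

/-! An `L`-digraph in which every label enters and leaves each vertex is a right action of the free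
group on `L`, so it suffices to find finite actions, free on short words, with an order that looks
the same around almost every point. The Magnus representation supplies both: the generator `a` acts
on noncommutative power series with constant term 1 by right multiplication by `1 + X a`. The series
attached to a nontrivial reduced word differs from 1 in some degree at most the length of the word
(`Magnus.exists_coef_ne_zero`). Truncating degrees and reducing coefficients modulo `m` gives a
finite action, and for large `m` no short nontrivial word has a fixed point
(`truncAction_freeUpTo`).

Words are ordered by their integral Magnus coefficients, compared lexicographically with monomials
of lower degree first. This order does not involve `m`, hence not `ε`. Points of the finite action
are ordered in the same way by the representatives of their coordinates in `[0, m)`. At the first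
monomial where words `g` and `h` differ, the points `x·g` and `x·h` differ by exactly the difference
of the two coefficients, because the constant term of `x` is 1 (`act_sub_act`). Both orders
therefore agree unless a coordinate wraps around modulo `m`. Short words have coefficients bounded
independently of `m`, so a union bound makes the exceptional points a proportion `O(1/m)`
(`exists_rightAction`).

Averaging over orbits gives a transitive action with the same density, whose Schreier digraph is
`H`. Any digraph with a label-preserving homomorphism to `H` inherits the local structure: its balls
embed in those of `H` and are described by the words readable from the centre, a prefix-closed set
(`IsHom.restrictIso`). This covers the product with `G` and its components; averaging again selects
a good component. -/

namespace LDigraph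

/-! ### Words read along the edges of a digraph -/

variable {L : Type u} {V : Type v} {W : Type w}

/-- A step along an edge with label `e.1`, forwards or backwards according to the sign `e.2`. -/
def Step (G : LDigraph L V) : L × Bool → V → V → Prop
  | (a, true), x, y => G.edge a x y
  | (a, false), x, y => G.edge a y x

/-- `G.Trace l x y`: one gets from `x` to `y` by reading the word `l`. -/
def Trace (G : LDigraph L V) : List (L × Bool) → V → V → Prop
  | [], x, y => x = y
  | e :: l, x, y => ∃ z, G.Step e x z ∧ G.Trace l z y

theorem Step.unique {G : LDigraph L V} {e : L × Bool} {x y z : V}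
    (h : G.Step e x y) (h' : G.Step e x z) : y = z := by
  obtain ⟨a, _ | _⟩ := e
  · exact G.in_proper a _ _ _ h h'
  · exact G.out_proper a _ _ _ h h'

theorem step_not {G : LDigraph L V} {a : L} {b : Bool} {x y : V} :
    G.Step (a, !b) x y ↔ G.Step (a, b) y x := by
  cases b <;> rfl

theorem Trace.unique {G : LDigraph L V} {l : List (L × Bool)} {x y z : V}
    (h : G.Trace l x y) (h' : G.Trace l x z) : y = z := by
  induction l generalizing x with
  | nil => exact h.symm.trans h'
  | cons e l ih =>
    obtain ⟨t, ht, h⟩ := h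
    obtain ⟨t', ht', h'⟩ := h'
    obtain rfl := ht.unique ht'
    exact ih h h'

theorem trace_append {G : LDigraph L V} {l l' : List (L × Bool)} {x y : V} :
    G.Trace (l ++ l') x y ↔ ∃ z, G.Trace l x z ∧ G.Trace l' z y := by
  induction l generalizing x with
  | nil => simp [Trace]
  | cons e l ih =>
    simp only [List.cons_append, Trace, ih]
    exact ⟨fun ⟨t, ht, z, hz, h⟩ => ⟨z, ⟨t, ht, hz⟩, h⟩, fun ⟨z, ⟨t, ht, hz⟩, h⟩ => ⟨t, ht, z, hz, h⟩⟩

theorem trace_singleton {G : LDigraph L V} {e : L × Bool} {x y : V} :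
    G.Trace [e] x y ↔ G.Step e x y := by
  simp [Trace]

/-- By properness of the labelling, a letter followed by its inverse returns to its starting point.
The converse fails in general, as the cancelled letter need not be readable. -/
theorem Trace.of_red {G : LDigraph L V} {l l' : List (L × Bool)} (hr : FreeGroup.Red l l')
    {x y : V} (h : G.Trace l x y) : G.Trace l' x y := by
  induction hr with
  | refl => exact h
  | tail _ hs ih =>
    obtain ⟨⟩ := hs
    obtain ⟨z, hz, t, ht, s, hs, h'⟩ := trace_append.1 ih
    rw [step_not] at hs
    refine trace_append.2 ⟨z, hz, ?_⟩
    rwa [(step_not.2 ht).unique (step_not.2 hs)]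

theorem Step.edist_le {G : LDigraph L V} {e : L × Bool} {x y : V} (h : G.Step e x y) :
    G.toSimpleGraph.edist x y ≤ 1 := by
  rw [SimpleGraph.edist_le_one_iff_adj_or_eq]
  by_cases hxy : x = y
  · exact Or.inr hxy
  · left
    obtain ⟨a, _ | _⟩ := e
    · exact ⟨hxy, Or.inr ⟨a, h⟩⟩
    · exact ⟨hxy, Or.inl ⟨a, h⟩⟩

theorem Trace.edist_le {G : LDigraph L V} {l : List (L × Bool)} {x y : V} (h : G.Trace l x y) :
    G.toSimpleGraph.edist x y ≤ l.length := by
  induction l generalizing x with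
  | nil => obtain rfl : x = y := h; simp
  | cons e l ih =>
    obtain ⟨z, hz, h⟩ := h
    refine (SimpleGraph.edist_triangle (v := z)).trans ?_
    rw [List.length_cons, Nat.cast_add, add_comm]
    exact add_le_add (ih h) (by simpa using hz.edist_le)

theorem exists_step_of_adj {G : LDigraph L V} {x y : V} (h : G.toSimpleGraph.Adj x y) :
    ∃ e, G.Step e x y := by
  obtain ⟨_, ⟨a, h⟩ | ⟨a, h⟩⟩ := h
  · exact ⟨(a, true), h⟩
  · exact ⟨(a, false), h⟩

theorem exists_trace_of_walk {G : LDigraph L V} {x y : V} (p : G.toSimpleGraph.Walk x y) :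
    ∃ l, l.length = p.length ∧ G.Trace l x y := by
  induction p with
  | nil => exact ⟨[], rfl, rfl⟩
  | cons h p ih =>
    obtain ⟨l, hl, ht⟩ := ih
    obtain ⟨e, he⟩ := exists_step_of_adj h
    exact ⟨e :: l, by simp [hl], _, he, ht⟩

/-- A cancelling pair of letters would make the path revisit a vertex. The clause on the first
letter is there for the induction: it identifies the vertex to which a cancellation would return. -/
theorem exists_isReduced_trace_of_isPath {G : LDigraph L V} {x y : V}
    (p : G.toSimpleGraph.Walk x y) (hp : p.IsPath) :
    ∃ l, l.length = p.length ∧ G.Trace l x y ∧ FreeGroup.IsReduced l ∧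
      ∀ e ∈ l.head?, G.Step e x p.snd := by
  induction p with
  | nil => exact ⟨[], rfl, rfl, by simp [FreeGroup.IsReduced], by simp⟩
  | @cons x t y h p ih =>
    rw [SimpleGraph.Walk.cons_isPath_iff] at hp
    obtain ⟨l, hl, ht, hr, hs⟩ := ih hp.1
    obtain ⟨⟨a, b⟩, he⟩ := exists_step_of_adj h
    refine ⟨(a, b) :: l, by simp [hl], ⟨_, he, ht⟩, ?_, by simpa using he⟩
    cases l with
    | nil => exact List.isChain_singleton _
    | cons e l =>
      rw [FreeGroup.isReduced_cons_cons]
      refine ⟨fun hab => ?_, hr⟩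
      by_contra hne
      obtain ⟨a', b'⟩ := e
      obtain rfl : a = a' := hab
      obtain rfl : b' = !b := by cases b <;> cases b' <;> simp_all
      have h1 : G.Step (a, !b) t p.snd := hs _ rfl
      have h2 : x = p.snd := (step_not.2 he : G.Step (a, !b) t x).unique h1
      exact hp.2 (h2 ▸ p.getVert_mem_support 1)

theorem mem_ball_of_trace {G : LDigraph L V} {r : ℕ} {l : List (L × Bool)} {x y : V}
    (h : G.Trace l x y) (hl : l.length ≤ r) : y ∈ G.ball r x :=
  h.edist_le.trans (by exact_mod_cast hl)

theorem exists_trace_of_mem_ball [DecidableEq L] {G : LDigraph L V} {r : ℕ} {x y : V}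
    (h : y ∈ G.ball r x) : ∃ g : FreeGroup L, g.norm ≤ r ∧ G.Trace g.toWord x y := by
  obtain ⟨p, hp⟩ := SimpleGraph.exists_walk_of_edist_ne_top
    (ne_top_of_le_ne_top (ENat.natCast_ne_top r) h)
  obtain ⟨l, hl, ht⟩ := exists_trace_of_walk p
  have h' : (p.length : ℕ∞) ≤ r := hp ▸ h
  refine ⟨FreeGroup.mk l, FreeGroup.norm_mk_le.trans (by rw [hl]; exact_mod_cast h'), ?_⟩
  rw [FreeGroup.toWord_mk]
  exact ht.of_red FreeGroup.reduce.red

theorem isReduced_append_singleton {l : List (L × Bool)} {e : L × Bool} :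
    FreeGroup.IsReduced (l ++ [e]) ↔
      FreeGroup.IsReduced l ∧ ∀ e' ∈ l.getLast?, e'.1 = e.1 → e'.2 = e.2 := by
  simp [FreeGroup.IsReduced, List.isChain_append]

theorem mk_append_singleton (l : List (L × Bool)) (a : L) :
    (FreeGroup.mk (l ++ [(a, true)]) : FreeGroup L) = FreeGroup.mk l * FreeGroup.of a := by
  rw [← FreeGroup.mul_mk]; rfl

theorem mk_append_singleton_false (l : List (L × Bool)) (a : L) :
    (FreeGroup.mk (l ++ [(a, false)]) : FreeGroup L) = FreeGroup.mk l * (FreeGroup.of a)⁻¹ := by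
  rw [← FreeGroup.mul_mk]; rfl

/-- Multiplying by a generator either appends a letter or cancels the last one. So of two adjacent
words in the tree one extends the other by a letter, and that letter is the edge found in
`Trace.edge_iff`. -/
theorem toWord_mul_of_or [DecidableEq L] (g : FreeGroup L) (a : L) :
    (g * FreeGroup.of a).toWord = g.toWord ++ [(a, true)] ∨
      g.toWord = (g * FreeGroup.of a).toWord ++ [(a, false)] := by
  by_cases h : FreeGroup.IsReduced (g.toWord ++ [(a, true)])
  · left
    rw [FreeGroup.toWord_mul, FreeGroup.toWord_of, h.reduce_eq]
  · right
    rw [isReduced_append_singleton] at h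
    push Not at h
    obtain ⟨⟨a', b⟩, h1, h2, h3⟩ := h FreeGroup.isReduced_toWord
    obtain rfl : a' = a := h2
    obtain rfl : b = false := by simpa using h3
    obtain ⟨l, hl⟩ := List.getLast?_eq_some_iff.1 h1
    have hr : FreeGroup.IsReduced (l ++ [(a', false)]) := hl ▸ FreeGroup.isReduced_toWord
    have hg : g * FreeGroup.of a' = FreeGroup.mk l := by
      rw [← FreeGroup.mk_toWord (x := g), hl, mk_append_singleton_false, inv_mul_cancel_right]
    rw [hl, hg, FreeGroup.toWord_mk, (isReduced_append_singleton.1 hr).1.reduce_eq]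

theorem Trace.edge_iff [DecidableEq L] {G : LDigraph L V} {x y z : V} {g : FreeGroup L} {a : L}
    (hy : G.Trace g.toWord x y) (hz : G.Trace (g * FreeGroup.of a).toWord x z) :
    G.edge a y z := by
  rcases toWord_mul_of_or g a with h | h
  · rw [h] at hz
    obtain ⟨t, ht, hs⟩ := trace_append.1 hz
    rw [hy.unique ht]
    exact trace_singleton.1 hs
  · rw [h] at hy
    obtain ⟨t, ht, hs⟩ := trace_append.1 hy
    rw [hz.unique ht]
    exact trace_singleton.1 hs

end LDigraph

/-! ### Actions of the free group and digraphs mapping to them -/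

/-- A right action of the free group on `L`. -/
structure FreeGroup.RightAction (L : Type u) (W : Type w) where
  act : W → FreeGroup L → W
  act_one : ∀ x, act x 1 = x
  act_mul : ∀ x g h, act x (g * h) = act (act x g) h

namespace FreeGroup.RightAction

variable {L : Type u} {W : Type w} (A : RightAction L W)

theorem act_mul_inv (x : W) (g : FreeGroup L) : A.act (A.act x g) g⁻¹ = x := by
  rw [← A.act_mul, mul_inv_cancel, A.act_one]

theorem act_inv_mul (x : W) (g : FreeGroup L) : A.act (A.act x g⁻¹) g = x := by
  rw [← A.act_mul, inv_mul_cancel, A.act_one]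

/-- No nontrivial reduced word of length at most `n` fixes a point. -/
def FreeUpTo [DecidableEq L] (n : ℕ) : Prop :=
  ∀ x (g : FreeGroup L), g.norm ≤ n → A.act x g = x → g = 1

/-- Any two points are in the same orbit. -/
def Transitive : Prop := ∀ x y, ∃ g, A.act x g = y

variable {A}

/-- The usual form in which freeness is applied: `g * h⁻¹` is a short word fixing `x`. -/
theorem FreeUpTo.eq [DecidableEq L] {n : ℕ} (hA : A.FreeUpTo n) {x : W} {g h : FreeGroup L}
    (hn : g.norm + h.norm ≤ n) (he : A.act x g = A.act x h) : g = h := by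
  have h1 : A.act x (g * h⁻¹) = x := by rw [A.act_mul, he, A.act_mul_inv]
  refine mul_inv_eq_one.1 (hA x _ ((FreeGroup.norm_mul_le _ _).trans ?_) h1)
  rwa [FreeGroup.norm_inv_eq]

theorem FreeUpTo.mono [DecidableEq L] {m n : ℕ} (hA : A.FreeUpTo n) (h : m ≤ n) : A.FreeUpTo m :=
  fun x g hg => hA x g (hg.trans h)

/-- The Schreier digraph of an action in which short words have no fixed points. -/
def digraph [DecidableEq L] (A : RightAction L W) (hA : A.FreeUpTo 2) : LDigraph L W where
  edge a x y := y = A.act x (FreeGroup.of a)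
  label_unique a b x y h h' :=
    FreeGroup.of_injective (hA.eq (by simp) (h.symm.trans h'))
  out_proper a x y z h h' := h.trans h'.symm
  in_proper a x y z h h' := by
    rw [← A.act_mul_inv y (FreeGroup.of a), ← A.act_mul_inv z (FreeGroup.of a), ← h, ← h']

/-- `π` sends edges of `C` to edges of the Schreier digraph of `A`. -/
def IsHom {V : Type v} (A : RightAction L W) (C : LDigraph L V) (π : V → W) : Prop :=
  ∀ a x y, C.edge a x y → π y = A.act (π x) (FreeGroup.of a)

section
variable {V : Type v} {C : LDigraph L V} {π : V → W}

theorem IsHom.trace (h : A.IsHom C π) {l : List (L × Bool)} {x y : V} (ht : C.Trace l x y) :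
    π y = A.act (π x) (FreeGroup.mk l) := by
  induction l generalizing x with
  | nil => obtain rfl : x = y := ht; exact (A.act_one _).symm
  | cons e l ih =>
    obtain ⟨z, hz, ht⟩ := ht
    have hm : (FreeGroup.mk (e :: l) : FreeGroup L) = FreeGroup.mk [e] * FreeGroup.mk l := by
      rw [FreeGroup.mul_mk]; rfl
    rw [hm, A.act_mul, ih ht]
    congr 1
    obtain ⟨a, _ | _⟩ := e
    · have : FreeGroup.mk [(a, false)] = (FreeGroup.of a)⁻¹ := rfl
      rw [this, h a z x hz, A.act_mul_inv]
    · exact h a x z hz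

theorem IsHom.trace_toWord [DecidableEq L] (h : A.IsHom C π) {g : FreeGroup L} {x y : V}
    (ht : C.Trace g.toWord x y) : π y = A.act (π x) g := by
  simpa [FreeGroup.mk_toWord] using h.trace ht

end

/-- Around `x` the order on `W` looks like the order `oStar` on the tree. -/
def IsOrderedAt [DecidableEq L] {r : ℕ} (A : RightAction L W) (oW : LinearOrder W)
    (oStar : LinearOrder (TreeVertex L r)) (x : W) : Prop :=
  ∀ g h : TreeVertex L r, oStar.lt g h ↔ oW.lt (A.act x g.1) (A.act x h.1)

section
variable [DecidableEq L] {V : Type v} {C : LDigraph L V} {π : V → W} {r : ℕ}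

/-- A prefix of a readable word is readable, so deleting last letters connects every such word to
the root inside the set. -/
theorem isSubtree_trace (C : LDigraph L V) (x : V) :
    TreeVertex.IsSubtree {g : TreeVertex L r | ∃ y, C.Trace g.1.toWord x y} := by
  set S : Set (TreeVertex L r) := {g | ∃ y, C.Trace g.1.toWord x y}
  have h0 : TreeVertex.root L r ∈ S := ⟨x, by simp [TreeVertex.root, LDigraph.Trace]⟩
  refine ⟨h0, ?_⟩
  have key : ∀ (l : List (L × Bool)) (g : S), g.1.1.toWord = l →
      ((TreeVertex.tree L r).induce S).toSimpleGraph.Reachable ⟨_, h0⟩ g := by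
    intro l
    induction l using List.reverseRecOn with
    | nil =>
      intro g hg
      have : g = ⟨_, h0⟩ := Subtype.ext (Subtype.ext (FreeGroup.toWord_eq_nil_iff.1 hg))
      rw [this]
    | append_singleton l e ih =>
      intro g hg
      obtain ⟨y, hy⟩ := g.2
      rw [hg] at hy
      obtain ⟨z, hz, hs⟩ := LDigraph.trace_append.1 hy
      have hr : FreeGroup.IsReduced (l ++ [e]) := hg ▸ FreeGroup.isReduced_toWord
      have hl := (LDigraph.isReduced_append_singleton.1 hr).1
      have hw : (FreeGroup.mk l).toWord = l := by rw [FreeGroup.toWord_mk, hl.reduce_eq]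
      have hn : (FreeGroup.mk l).norm ≤ r := by
        have h1 : g.1.1.norm ≤ r := g.1.2
        unfold FreeGroup.norm at h1 ⊢
        rw [hg] at h1
        rw [hw]
        simp at h1
        omega
      let g' : S := ⟨⟨FreeGroup.mk l, hn⟩, z, by rwa [hw]⟩
      refine (ih g' hw).trans (SimpleGraph.Adj.reachable ⟨?_, ?_⟩)
      · intro h
        have : l = l ++ [e] := by
          rw [← hg, ← h]; exact hw.symm
        simp at this
      · have hg' : g.1.1 = FreeGroup.mk (l ++ [e]) := by rw [← hg, FreeGroup.mk_toWord]
        obtain ⟨a, _ | _⟩ := e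
        · right
          refine ⟨a, ?_⟩
          show FreeGroup.mk l = g.1.1 * FreeGroup.of a
          rw [hg', LDigraph.mk_append_singleton_false, inv_mul_cancel_right]
        · left
          refine ⟨a, ?_⟩
          show g.1.1 = FreeGroup.mk l * FreeGroup.of a
          rw [hg', LDigraph.mk_append_singleton]
  have : Nonempty S := ⟨⟨_, h0⟩⟩
  exact SimpleGraph.Connected.mk fun g h => ((key _ g rfl).symm.trans (key _ h rfl))

/-- Each vertex of the ball is sent to a short word leading to it. Freeness of the action at `π x`
makes this word unique, turns edges of `C` into tree edges, and makes `π` injective on the ball, so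
the order can be compared in `W`. -/
theorem IsHom.restrictIso (hC : A.IsHom C π) (hA : A.FreeUpTo (2 * r + 1)) {oW : LinearOrder W}
    {oStar : LinearOrder (TreeVertex L r)} {o : LinearOrder V}
    (ho : ∀ y z, π y ≠ π z → (o.lt y z ↔ oW.lt (π y) (π z))) {x : V}
    (hx : A.IsOrderedAt oW oStar (π x)) :
    C.RestrictIso o x (C.ball r x) (TreeVertex.tree L r) oStar (TreeVertex.root L r)
      {g : TreeVertex L r | ∃ y, C.Trace g.1.toWord x y} := by
  set S : Set (TreeVertex L r) := {g | ∃ y, C.Trace g.1.toWord x y}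
  choose f hf1 hf2 using fun y : C.ball r x => LDigraph.exists_trace_of_mem_ball y.2
  let F : C.ball r x → S := fun y => ⟨⟨f y, hf1 y⟩, y, hf2 y⟩
  have hinj : Function.Injective F := fun y z h => by
    have h' : f y = f z := congrArg (fun g : S => g.1.1) h
    have := hf2 z
    rw [← h'] at this
    exact Subtype.ext ((hf2 y).unique this)
  have hsurj : Function.Surjective F := fun ⟨g, y, hy⟩ => by
    have hyb : y ∈ C.ball r x := LDigraph.mem_ball_of_trace hy g.2
    refine ⟨⟨y, hyb⟩, Subtype.ext (Subtype.ext (hA.eq (x := π x) ?_ ?_))⟩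
    · have := hf1 ⟨y, hyb⟩
      have := g.2
      show (f _).norm + g.1.norm ≤ _
      omega
    · show A.act (π x) (f ⟨y, hyb⟩) = _
      rw [← hC.trace_toWord hy, ← hC.trace_toWord (hf2 ⟨y, hyb⟩)]
  have hπ : ∀ y : C.ball r x, π y = A.act (π x) (f y) := fun y => hC.trace_toWord (hf2 y)
  refine ⟨Equiv.ofBijective F ⟨hinj, hsurj⟩, ?_, ?_, ?_⟩
  · intro y
    show (y : V) = x ↔ (⟨f y, hf1 y⟩ : TreeVertex L r) = TreeVertex.root L r
    constructor
    · intro h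
      refine Subtype.ext (hA (π x) _ ((hf1 y).trans (by omega)) ?_)
      rw [← hπ, h]
    · intro h
      have h' : f y = 1 := congrArg Subtype.val h
      have := hf2 y
      rw [h'] at this
      simpa [LDigraph.Trace] using this.symm
  · intro a y z
    show C.edge a y z ↔ f z = f y * FreeGroup.of a
    constructor
    · intro h
      -- The lengths `r + 1` and `r` are added here, which accounts for the bound `2 * r + 1`.
      refine hA.eq (x := π x) ?_ ?_
      · have h1 := hf1 y
        have h2 := hf1 z
        have h3 := FreeGroup.norm_mul_le (f y) (FreeGroup.of a)
        rw [FreeGroup.norm_of] at h3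
        omega
      · rw [A.act_mul, ← hπ, ← hπ]
        exact hC a _ _ h
    · intro h
      exact (hf2 y).edge_iff (h ▸ hf2 z)
  · intro y z
    show o.lt y z ↔ oStar.lt ⟨f y, hf1 y⟩ ⟨f z, hf1 z⟩
    have hx' := hx ⟨f y, hf1 y⟩ ⟨f z, hf1 z⟩
    refine Iff.trans ?_ hx'.symm
    show _ ↔ oW.lt (A.act (π x) (f y)) (A.act (π x) (f z))
    rw [← hπ, ← hπ]
    -- `ho` says nothing about points with the same image, but within the ball these coincide.
    by_cases h : π y = π z
    · have hyz : y = z := hinj (Subtype.ext (Subtype.ext (hA.eq (x := π x)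
        (by have h1 := hf1 y; have h2 := hf1 z; show (f y).norm + (f z).norm ≤ _; omega)
        (by show A.act _ (f y) = A.act _ (f z); rw [← hπ, ← hπ, h]))))
      subst hyz
      exact iff_of_false (lt_irrefl (y : V)) (lt_irrefl (π y))
    · exact ho y z h

theorem IsHom.mem_subtreeVertices (hC : A.IsHom C π) (hA : A.FreeUpTo (2 * r + 1))
    {oW : LinearOrder W} {oStar : LinearOrder (TreeVertex L r)} {o : LinearOrder V}
    (ho : ∀ y z, π y ≠ π z → (o.lt y z ↔ oW.lt (π y) (π z))) {x : V}
    (hx : A.IsOrderedAt oW oStar (π x)) : x ∈ C.subtreeVertices o oStar :=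
  ⟨_, isSubtree_trace C x, hC.restrictIso hA ho hx⟩

end

/-! ### The Schreier digraph: connectedness, degrees, girth -/

section
variable [DecidableEq L] {hA2 : A.FreeUpTo 2} {r : ℕ}

theorem digraph_isHom : A.IsHom (A.digraph hA2) id := fun _ _ _ h => h

theorem digraph_step (x : W) (e : L × Bool) :
    (A.digraph hA2).Step e x (A.act x (FreeGroup.mk [e])) := by
  obtain ⟨a, _ | _⟩ := e
  · exact (A.act_inv_mul x (FreeGroup.of a)).symm
  · rfl

theorem digraph_trace (x : W) (l : List (L × Bool)) :
    (A.digraph hA2).Trace l x (A.act x (FreeGroup.mk l)) := by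
  induction l generalizing x with
  | nil => exact (A.act_one x).symm
  | cons e l ih =>
    refine ⟨_, digraph_step x e, ?_⟩
    have hm : (FreeGroup.mk (e :: l) : FreeGroup L) = FreeGroup.mk [e] * FreeGroup.mk l := by
      rw [FreeGroup.mul_mk]; rfl
    rw [hm, A.act_mul]
    exact ih _

theorem mem_typeVertices (hA : A.FreeUpTo (2 * r + 1)) {oW : LinearOrder W}
    {oStar : LinearOrder (TreeVertex L r)} {x : W} (hx : A.IsOrderedAt oW oStar x) :
    x ∈ (A.digraph hA2).typeVertices oW oStar := by
  have h := (digraph_isHom (hA2 := hA2)).restrictIso hA (o := oW) (oW := oW)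
    (fun _ _ _ => Iff.rfl) hx
  have hS : {g : TreeVertex L r | ∃ y, (A.digraph hA2).Trace g.1.toWord x y} = Set.univ :=
    Set.eq_univ_of_forall fun g => ⟨_, digraph_trace x _⟩
  rwa [hS] at h

theorem digraph_connected [Nonempty W] (hT : A.Transitive) : (A.digraph hA2).Connected := by
  refine SimpleGraph.Connected.mk fun x y => ?_
  obtain ⟨g, rfl⟩ := hT x y
  have h := (digraph_trace (hA2 := hA2) x g.toWord).edist_le
  rw [FreeGroup.mk_toWord] at h
  exact SimpleGraph.reachable_of_edist_ne_top (ne_top_of_le_ne_top (ENat.natCast_ne_top _) h)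

theorem digraph_isOriented : (A.digraph hA2).IsOriented := by
  intro a b x y h h'
  have h1 : A.act x (FreeGroup.of a * FreeGroup.of b) = x := by
    rw [A.act_mul, ← show y = A.act x (FreeGroup.of a) from h]
    exact h'.symm
  have h2 := hA2 x _ ((FreeGroup.norm_mul_le _ _).trans (by simp)) h1
  -- The exponent sum shows that a product of two generators is never trivial.
  let φ : FreeGroup L →* Multiplicative ℤ := FreeGroup.lift fun _ => Multiplicative.ofAdd 1
  have h3 : φ (FreeGroup.of a * FreeGroup.of b) = φ 1 := by rw [h2]
  have h4 : (1 : ℤ) + 1 = 0 := by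
    simpa [φ] using congrArg Multiplicative.toAdd h3
  omega

theorem digraph_outDegree (x : W) : (A.digraph hA2).outDegree x = Nat.card L := by
  have : {y | ∃ a, (A.digraph hA2).edge a x y} = Set.range fun a => A.act x (FreeGroup.of a) := by
    ext y
    exact exists_congr fun a => eq_comm
  rw [LDigraph.outDegree, this, ← Set.image_univ, Set.ncard_image_of_injective, Set.ncard_univ]
  exact fun a b h => FreeGroup.of_injective (hA2.eq (by simp) h)

theorem digraph_inDegree (x : W) : (A.digraph hA2).inDegree x = Nat.card L := by
  have : {y | ∃ a, (A.digraph hA2).edge a y x} =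
      Set.range fun a => A.act x (FreeGroup.of a)⁻¹ := by
    ext y
    refine exists_congr fun a => ⟨?_, ?_⟩
    · rintro (rfl : x = _)
      exact A.act_mul_inv _ _
    · rintro rfl
      exact (A.act_inv_mul _ _).symm
  rw [LDigraph.inDegree, this, ← Set.image_univ, Set.ncard_image_of_injective, Set.ncard_univ]
  exact fun a b h => FreeGroup.of_injective (inv_injective (hA2.eq (by simp) h))

theorem digraph_isRegular : (A.digraph hA2).IsRegular (2 * Nat.card L) := fun x => by
  rw [digraph_outDegree, digraph_inDegree, two_mul]

/-- A cycle is an edge together with a path joining its ends. The path reads a reduced word and the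
edge a single letter, with the same endpoints; if the cycle were short, freeness would make the two
words equal, leaving a path of length one and a cycle of length two. -/
theorem lt_egirth {n : ℕ} (hA : A.FreeUpTo n) :
    (n : ℕ∞) < (A.digraph hA2).toSimpleGraph.egirth := by
  refine lt_of_lt_of_le (b := ((n + 1 : ℕ) : ℕ∞)) (by exact_mod_cast n.lt_succ_self) ?_
  rw [SimpleGraph.le_egirth]
  intro x c hc
  have h3 := hc.three_le_length
  cases c with
  | nil => simp at h3
  | @cons _ y _ h p =>
    rw [SimpleGraph.Walk.cons_isCycle_iff] at hc
    by_contra hlt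
    have hlen : p.length + 1 ≤ n := by
      rw [not_le, Nat.cast_lt, SimpleGraph.Walk.length_cons] at hlt
      omega
    obtain ⟨l, hl, ht, hr, -⟩ := LDigraph.exists_isReduced_trace_of_isPath p hc.1
    obtain ⟨e, he⟩ := LDigraph.exists_step_of_adj h.symm
    have h1 := (digraph_isHom (hA2 := hA2)).trace ht
    have h2 := (digraph_isHom (hA2 := hA2)).trace (LDigraph.trace_singleton.2 he)
    have hw : (FreeGroup.mk l).toWord = l := by rw [FreeGroup.toWord_mk, hr.reduce_eq]
    have hw' : (FreeGroup.mk [e]).toWord = [e] := by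
      rw [FreeGroup.toWord_mk, FreeGroup.reduce_singleton]
    have h4 : FreeGroup.mk l = FreeGroup.mk [e] := by
      refine hA.eq ?_ (h1.symm.trans h2)
      rw [FreeGroup.norm, FreeGroup.norm, hw, hw', hl]
      simpa using hlen
    have h5 := congrArg (fun g => (FreeGroup.toWord g).length) h4
    simp only [hw, hw', hl, List.length_singleton] at h5
    rw [SimpleGraph.Walk.length_cons] at h3
    omega

end

end FreeGroup.RightAction

/-! ### The Magnus representation on noncommutative power series -/

namespace Magnus

open FreeGroup

variable {L : Type u} [DecidableEq L] {R : Type v} [CommRing R]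

/-- Right multiplication by `1 + X a` on noncommutative power series, the coefficient of a monomial
being indexed by the list of its letters from right to left. -/
def shift (a : L) (f : List L → R) : List L → R
  | [] => f []
  | b :: M => f (b :: M) + if b = a then f M else 0

/-- Right division by `1 + X a`. -/
def unshift (a : L) (f : List L → R) : List L → R
  | [] => f []
  | b :: M => f (b :: M) - if b = a then unshift a f M else 0

theorem shift_unshift (a : L) (f : List L → R) : shift a (unshift a f) = f := by
  funext M
  cases M <;> simp [shift, unshift]

theorem unshift_shift (a : L) (f : List L → R) : unshift a (shift a f) = f := by
  funext M
  induction M with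
  | nil => rfl
  | cons b M ih => simp [shift, unshift, ih]

/-- Right multiplication by `1 + X a`, as a permutation. -/
def shiftPerm (a : L) : Equiv.Perm (List L → R) where
  toFun := shift a
  invFun := unshift a
  left_inv := unshift_shift a
  right_inv := shift_unshift a

/-- The action of the free group on noncommutative power series in which the generator `a` acts
by right multiplication by `1 + X a`. -/
def seriesAction (L : Type u) [DecidableEq L] (R : Type v) [CommRing R] :
    RightAction L (List L → R) where
  act f g := (FreeGroup.lift (fun a => MulOpposite.op (shiftPerm (R := R) a)) g).unop f
  act_one f := by simp
  act_mul f g h := by simp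

theorem act_of (f : List L → R) (a : L) : (seriesAction L R).act f (of a) = shift a f := by
  simp [seriesAction, shiftPerm]

theorem act_of_inv (f : List L → R) (a : L) :
    (seriesAction L R).act f (of a)⁻¹ = unshift a f := by
  conv_lhs => rw [← shift_unshift a f, ← act_of]
  rw [RightAction.act_mul_inv]

/-- Cauchy product of an integral power series with a power series over `R`. -/
def conv (c : List L → ℤ) (x : List L → R) (M : List L) : R :=
  ∑ i ∈ Finset.range (M.length + 1), (c (M.take i) : R) * x (M.drop i)

omit [DecidableEq L] in
theorem conv_nil (c : List L → ℤ) (x : List L → R) : conv c x [] = c [] * x [] := by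
  simp [conv]

omit [DecidableEq L] in
theorem conv_cons (c : List L → ℤ) (x : List L → R) (b : L) (M : List L) :
    conv c x (b :: M) = c [] * x (b :: M) + conv (fun N => c (b :: N)) x M := by
  rw [conv, List.length_cons, Finset.sum_range_succ']
  simp [conv, add_comm]

theorem shift_conv (a : L) (c : List L → ℤ) (x : List L → R) :
    shift a (conv c x) = conv (shift a c) x := by
  funext M
  cases M with
  | nil => simp [shift, conv_nil]
  | cons b M =>
    rw [shift, conv_cons, conv_cons]
    by_cases h : b = a
    · simp [shift, h, conv, add_mul, Finset.sum_add_distrib, add_assoc]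
    · simp [shift, h]

/-- Associativity: the action multiplies on the right, so it commutes with left multiplication by
`x`. -/
theorem act_conv (c : List L → ℤ) (x : List L → R) (g : FreeGroup L) :
    (seriesAction L R).act (conv c x) g = conv ((seriesAction L ℤ).act c g) x := by
  induction g using FreeGroup.induction_on generalizing c with
  | C1 => simp [RightAction.act_one]
  | of a => rw [act_of, act_of, shift_conv]
  | inv_of a _ =>
    rw [act_of_inv, act_of_inv]
    conv_lhs => rw [← shift_unshift a c, ← shift_conv, unshift_shift]
  | mul g h hg hh => rw [RightAction.act_mul, RightAction.act_mul, hg, hh]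

/-- The power series `1`. -/
def base : List L → ℤ := fun M => if M = [] then 1 else 0

/-- The coefficients of the image of `g` under the Magnus embedding. -/
def coef (g : FreeGroup L) : List L → ℤ := (seriesAction L ℤ).act base g

omit [DecidableEq L] in
theorem conv_base (x : List L → R) : conv base x = x := by
  funext M
  rw [conv, Finset.sum_eq_single 0]
  · simp [base]
  · intro i hi h0
    have : M.take i ≠ [] := by
      cases M with
      | nil => simp at hi; exact absurd hi h0
      | cons b M => simp [h0]
    simp [base, this]
  · simp

/-- As monomials are stored from right to left, `x` is the left factor in `conv`: acting by `g` is
right multiplication by the Magnus series of `g`. -/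
theorem act_eq_conv (x : List L → R) (g : FreeGroup L) :
    (seriesAction L R).act x g = conv (coef g) x := by
  conv_lhs => rw [← conv_base x]
  exact act_conv _ _ _

theorem act_nil (x : List L → R) (g : FreeGroup L) : (seriesAction L R).act x g [] = x [] := by
  induction g using FreeGroup.induction_on generalizing x with
  | C1 => simp [RightAction.act_one]
  | of a => rw [act_of, shift]
  | inv_of a _ => rw [act_of_inv, unshift]
  | mul g h hg hh => rw [RightAction.act_mul, hh, hg]

theorem coef_nil (g : FreeGroup L) : coef g [] = 1 := by
  rw [coef, act_nil]; rfl

theorem coef_one : coef (1 : FreeGroup L) = base := RightAction.act_one _ _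

/-- A coefficient of a product involves no higher degree of the factors. This is what allows
truncation. -/
theorem act_congr {x y : List L → R} {k : ℕ} (h : ∀ M, M.length ≤ k → x M = y M)
    (g : FreeGroup L) {M : List L} (hM : M.length ≤ k) :
    (seriesAction L R).act x g M = (seriesAction L R).act y g M := by
  rw [act_eq_conv, act_eq_conv, conv, conv]
  refine Finset.sum_congr rfl fun i _ => ?_
  rw [h _ (by simp; omega)]

/-- In the Cauchy product only the term pairing all of `M` with the constant term of `x` survives
subtraction. The difference thus depends on `x` only through `x []`, whence the normalisation to 1
later. -/
theorem act_sub_act (x : List L → R) {g h : FreeGroup L} {M : List L}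
    (hM : ∀ N : List L, N.length < M.length → coef g N = coef h N) :
    (seriesAction L R).act x g M - (seriesAction L R).act x h M
      = ((coef g M - coef h M : ℤ) : R) * x [] := by
  rw [act_eq_conv, act_eq_conv, conv, conv, Finset.sum_range_succ, Finset.sum_range_succ,
    Finset.sum_congr rfl fun i hi => by
      rw [hM (M.take i) (by have := Finset.mem_range.1 hi; simp; omega)]]
  simp
  ring

/-! ### Injectivity of the Magnus embedding -/

section Nontrivial

/-- A monomial in which consecutive letters are distinct. -/
def Alternating (M : List L) : Prop := M.IsChain (· ≠ ·)

/-- The sign of a letter. -/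
def sign (b : Bool) : ℤ := cond b 1 (-1)

omit [DecidableEq L] in
theorem Alternating.tail {b : L} {M : List L} (h : Alternating (b :: M)) : Alternating M :=
  List.IsChain.tail h

omit [DecidableEq L] in
theorem alternating_cons {b : L} {M : List L} :
    Alternating (b :: M) ↔ (∀ c ∈ M.head?, b ≠ c) ∧ Alternating M :=
  List.isChain_cons

theorem unshift_eq_self {a : L} {f : List L → R} {M : List L} (h : ∀ c ∈ M.head?, a ≠ c) :
    unshift a f M = f M := by
  cases M with
  | nil => rfl
  | cons b M => simp [unshift, (h b rfl).symm]

/-- The inverse of `1 + X a` is `1 - X a + X a ^ 2 - ⋯`, and the terms from the square on do not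
contribute to a monomial without equal neighbours. -/
theorem act_letter (f : List L → ℤ) (a : L) (s : Bool) {b : L} {N : List L}
    (h : Alternating (b :: N)) : (seriesAction L ℤ).act f (mk [(a, s)]) (b :: N)
      = f (b :: N) + if b = a then sign s * f N else 0 := by
  cases s with
  | true =>
    show (seriesAction L ℤ).act f (of a) (b :: N) = _
    rw [act_of, shift]
    simp [sign]
  | false =>
    have : mk [(a, false)] = (of a)⁻¹ := rfl
    rw [this, act_of_inv, unshift]
    by_cases hb : b = a
    · subst hb
      simp [sign, unshift_eq_self (alternating_cons.1 h).1, sub_eq_add_neg]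
    · simp [hb]

omit [DecidableEq L] in
theorem sign_mul_sign (s : Bool) : sign s * sign s = 1 := by
  cases s <;> rfl

theorem coef_append (l : List (L × Bool)) (e : L × Bool) :
    coef (mk (l ++ [e])) = (seriesAction L ℤ).act (coef (mk l)) (mk [e]) := by
  rw [← FreeGroup.mul_mk, coef, RightAction.act_mul]; rfl

/-- For a word with syllables `a₁ ^ n₁ ⋯ aₖ ^ nₖ`, the monomial `M` is `X a₁ ⋯ X aₖ`, with
coefficient `n₁ ⋯ nₖ`. The sign clause records that `nₖ` has the sign of the last letter, so
lengthening the last syllable cannot make the coefficient vanish; the sublist clause ensures that a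
new syllable starts from coefficient zero. -/
theorem exists_leading_monomial (l : List (L × Bool)) (hl : IsReduced l) :
    ∃ M : List L, Alternating M ∧ M.length ≤ l.length ∧ coef (mk l) M ≠ 0 ∧
      (∀ N, Alternating N → coef (mk l) N ≠ 0 → N.Sublist M) ∧
      (l = [] → M = []) ∧
      ∀ e ∈ l.getLast?, ∃ M', M = e.1 :: M' ∧
        0 < sign e.2 * coef (mk l) M * coef (mk l) M' := by
  induction l using List.reverseRecOn with
  | nil =>
    refine ⟨[], List.isChain_nil, le_rfl, ?_, ?_, fun _ => rfl, by simp⟩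
    · rw [coef_nil]; exact one_ne_zero
    · intro N _ hN
      rw [← one_eq_mk, coef_one, base] at hN
      by_cases h : N = []
      · rw [h]
      · simp [h] at hN
  | append_singleton l e ih =>
    obtain ⟨a, s⟩ := e
    obtain ⟨hl, hlast⟩ := LDigraph.isReduced_append_singleton.1 hl
    obtain ⟨M, hM, hlen, hne, hsupp, hnil, hsign⟩ := ih hl
    rw [coef_append]
    have hnew := fun b N => act_letter (coef (mk l)) a s (b := b) (N := N)
    have hnew0 := act_nil (coef (mk l)) (mk [(a, s)])
    set c := coef (mk l)
    set c' := (seriesAction L ℤ).act c (mk [(a, s)])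
    have hsame : ∀ N, Alternating N → (∀ b ∈ N.head?, a ≠ b) → c' N = c N := by
      intro N hN hh
      cases N with
      | nil => exact hnew0
      | cons b N => rw [hnew b N hN, if_neg (hh b rfl).symm, add_zero]
    have hpos : ∀ z : ℤ, z ≠ 0 → 0 < z * z := fun z hz => mul_self_pos.2 hz
    -- If `M` begins with `a`, the new letter prolongs the last syllable, with the same sign as the
    -- word is reduced; otherwise it opens a new syllable and `a :: M` becomes the leading monomial.
    by_cases hMa : ∃ M', M = a :: M'
    · obtain ⟨M', rfl⟩ := hMa
      obtain ⟨hM'a, hM'⟩ := alternating_cons.1 hM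
      have hlne : l ≠ [] := fun h => by simpa using hnil h
      obtain ⟨e, he⟩ := Option.isSome_iff_exists.1 (List.getLast?_isSome.2 hlne)
      obtain ⟨M'', hM'', hs⟩ := hsign e he
      obtain ⟨h1, rfl⟩ := List.cons_eq_cons.1 hM''
      obtain rfl : e.2 = s := hlast e he h1.symm
      have hval : c' (a :: M') = c (a :: M') + sign e.2 * c M' := by rw [hnew a M' hM, if_pos rfl]
      have hval' : c' M' = c M' := hsame M' hM' hM'a
      have hc : c M' ≠ 0 := fun h => by rw [h, mul_zero] at hs; exact lt_irrefl _ hs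
      have hp : 0 < sign e.2 * c' (a :: M') * c' M' := by
        rw [hval, hval']
        have := hpos _ hc
        have h2 := sign_mul_sign e.2
        have : sign e.2 * (c (a :: M') + sign e.2 * c M') * c M' =
          sign e.2 * c (a :: M') * c M' + (sign e.2 * sign e.2) * (c M' * c M') := by ring
        rw [this, h2]
        linarith
      refine ⟨a :: M', hM, by simp at hlen ⊢; omega, ?_, ?_, by simp, ?_⟩
      · intro h
        rw [h] at hp
        simp at hp
      · intro N hN hN0
        by_cases hcN : c N = 0
        · cases N with
          | nil => exact List.nil_sublist _
          | cons b N =>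
            rw [hnew b N hN, hcN, zero_add] at hN0
            obtain rfl : b = a := by by_contra h; simp [h] at hN0
            rw [if_pos rfl] at hN0
            obtain ⟨hNb, hN'⟩ := alternating_cons.1 hN
            have h3 := hsupp N hN' (right_ne_zero_of_mul hN0)
            rcases List.sublist_cons_iff.1 h3 with h4 | ⟨r, h4, -⟩
            · exact h4.cons_cons b
            · rw [h4] at hNb
              exact absurd rfl (hNb b rfl)
        · exact hsupp N hN hcN
      · intro e' he'
        simp at he'
        subst he'
        exact ⟨M', rfl, hp⟩
    · have hMa' : ∀ b ∈ M.head?, a ≠ b := by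
        rintro b hb rfl
        cases M with
        | nil => simp at hb
        | cons b' M =>
          simp at hb
          exact hMa ⟨M, by rw [hb]⟩
      have hMM : Alternating (a :: M) := alternating_cons.2 ⟨hMa', hM⟩
      have hc0 : c (a :: M) = 0 := by
        by_contra h
        have := (hsupp _ hMM h).length_le
        simp at this
      have hval : c' (a :: M) = sign s * c M := by rw [hnew a M hMM, if_pos rfl, hc0, zero_add]
      have hval' : c' M = c M := hsame M hM hMa'
      have hp : 0 < sign s * c' (a :: M) * c' M := by
        rw [hval, hval', ← mul_assoc, sign_mul_sign, one_mul]
        exact hpos _ hne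
      refine ⟨a :: M, hMM, by simp; omega, ?_, ?_, by simp, ?_⟩
      · intro h
        rw [h] at hp
        simp at hp
      · intro N hN hN0
        by_cases hcN : c N = 0
        · cases N with
          | nil => exact List.nil_sublist _
          | cons b N =>
            rw [hnew b N hN, hcN, zero_add] at hN0
            obtain rfl : b = a := by by_contra h; simp [h] at hN0
            rw [if_pos rfl] at hN0
            exact (hsupp N hN.tail (right_ne_zero_of_mul hN0)).cons_cons b
        · exact (hsupp N hN hcN).cons a
      · intro e' he'
        simp at he'
        subst he'
        exact ⟨M, rfl, hp⟩

/-- The Magnus embedding is injective; the nontriviality of `g` is seen in degrees at most the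
length of `g`. -/
theorem exists_coef_ne_zero {g : FreeGroup L} (hg : g ≠ 1) :
    ∃ M : List L, M ≠ [] ∧ M.length ≤ g.norm ∧ coef g M ≠ 0 := by
  obtain ⟨M, -, hlen, hne, -, -, h⟩ := exists_leading_monomial g.toWord isReduced_toWord
  rw [mk_toWord] at hne
  have hgl : g.toWord ≠ [] := fun h => hg (toWord_eq_nil_iff.1 h)
  obtain ⟨e, he⟩ := Option.isSome_iff_exists.1 (List.getLast?_isSome.2 hgl)
  obtain ⟨M', rfl, -⟩ := h e he
  exact ⟨_, List.cons_ne_nil _ _, hlen, hne⟩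

/-- Multiplying both series by that of `h⁻¹` shows that `g * h⁻¹` has no nonconstant term of degree
at most `k`, which bounds its length. -/
theorem eq_of_coef_eq {g h : FreeGroup L} {k : ℕ} (hk : g.norm + h.norm ≤ k)
    (hc : ∀ M : List L, M ≠ [] → M.length ≤ k → coef g M = coef h M) : g = h := by
  by_contra hne
  obtain ⟨M, hM0, hMl, hM⟩ := exists_coef_ne_zero (g := g * h⁻¹) (by rwa [Ne, mul_inv_eq_one])
  have hMk : M.length ≤ k := by
    have := FreeGroup.norm_mul_le g h⁻¹
    rw [FreeGroup.norm_inv_eq] at this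
    omega
  apply hM
  have h1 : coef (g * h⁻¹) = (seriesAction L ℤ).act (coef g) h⁻¹ := RightAction.act_mul _ _ _ _
  have h2 : (seriesAction L ℤ).act (coef h) h⁻¹ = base := RightAction.act_mul_inv _ _ _
  rw [h1, act_congr (y := coef h) (k := k) _ _ hMk, h2, base, if_neg hM0]
  intro N hN
  by_cases hN0 : N = []
  · rw [hN0, coef_nil, coef_nil]
  · exact hc N hN0 hN

end Nontrivial

end Magnus

/-! ### The truncated action modulo `m` -/

namespace Magnus

open FreeGroup

variable {L : Type u} [DecidableEq L] {R : Type v} [CommRing R]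

/-- The nonconstant monomials of degree at most `k`. -/
abbrev Monomial (L : Type u) (k : ℕ) : Type u := {M : List L // M ≠ [] ∧ M.length ≤ k}

/-- The polynomial of degree at most `k` with constant term `1` and the given coefficients. -/
def extend {k : ℕ} (x : Monomial L k → R) (M : List L) : R :=
  if M = [] then 1 else if h : M ≠ [] ∧ M.length ≤ k then x ⟨M, h⟩ else 0

omit [DecidableEq L] in
theorem extend_nil {k : ℕ} (x : Monomial L k → R) : extend x [] = 1 := if_pos rfl

omit [DecidableEq L] in
theorem extend_val {k : ℕ} (x : Monomial L k → R) (M : Monomial L k) : extend x M.1 = x M := by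
  rw [extend, if_neg M.2.1, dif_pos M.2]

omit [DecidableEq L] in
theorem extend_restrict {k : ℕ} {f : List L → R} (hf : f [] = 1) {M : List L}
    (hM : M.length ≤ k) : extend (fun N : Monomial L k => f N.1) M = f M := by
  by_cases h : M = []
  · rw [h, extend_nil, hf]
  · rw [extend, if_neg h, dif_pos ⟨h, hM⟩]

/-- The action of the free group on truncated power series with constant term `1`. -/
def truncAction (L : Type u) [DecidableEq L] (R : Type v) [CommRing R] (k : ℕ) :
    RightAction L (Monomial L k → R) where
  act x g M := (seriesAction L R).act (extend x) g M.1
  act_one x := by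
    funext M
    rw [RightAction.act_one, extend_val]
  act_mul x g h := by
    funext M
    rw [RightAction.act_mul]
    exact (act_congr (fun N hN => extend_restrict (by rw [act_nil, extend_nil]) hN) h M.2.2).symm

theorem truncAction_sub {k : ℕ} (x : Monomial L k → R) {g h : FreeGroup L} {M : Monomial L k}
    (hM : ∀ N : Monomial L k, N.1.length < M.1.length → coef g N.1 = coef h N.1) :
    (truncAction L R k).act x g M - (truncAction L R k).act x h M
      = ((coef g M.1 - coef h M.1 : ℤ) : R) := by
  have := act_sub_act (extend x) (g := g) (h := h) (M := M.1) fun N hN => by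
    by_cases h : N = []
    · rw [h, coef_nil, coef_nil]
    · exact hM ⟨N, h, hN.le.trans M.2.2⟩ hN
  rwa [extend_nil, mul_one] at this

omit [DecidableEq L] in
theorem finite_monomial [Finite L] (k : ℕ) : Finite (Monomial L k) :=
  ((List.finite_length_le L k).subset fun _ h => h.2).to_subtype

theorem finite_treeVertex [Finite L] (k : ℕ) : Finite (TreeVertex L k) := by
  have := (List.finite_length_le (L × Bool) k).to_subtype
  refine Finite.of_injective (β := {l : List (L × Bool) | l.length ≤ k})
    (fun g : TreeVertex L k => ⟨g.1.toWord, g.2⟩) fun g h hgh => ?_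
  exact Subtype.ext (toWord_injective (congrArg Subtype.val hgh))

theorem exists_coef_bound [Finite L] (k : ℕ) : ∃ C : ℕ, ∀ g : FreeGroup L, g.norm ≤ k →
    ∀ M : List L, M.length ≤ k → |coef g M| ≤ C := by
  have := finite_treeVertex (L := L) k
  have := (List.finite_length_le L k).to_subtype
  obtain ⟨C, hC⟩ := Finite.exists_le fun p : TreeVertex L k × {M : List L | M.length ≤ k} =>
    (coef p.1.1 p.2.1).natAbs
  refine ⟨C, fun g hg M hM => ?_⟩
  rw [Int.abs_eq_natAbs]
  exact_mod_cast hC (⟨g, hg⟩, ⟨M, hM⟩)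

/-- At a monomial of least degree where `g` has a nonzero coefficient, `g` translates the coordinate
of every point by that coefficient, which is too small to vanish modulo `m`. -/
theorem truncAction_freeUpTo {k m : ℕ} {C : ℕ} (hC : ∀ g : FreeGroup L, g.norm ≤ k →
    ∀ M : List L, M.length ≤ k → |coef g M| ≤ C) (hm : C < m) :
    (truncAction L (ZMod m) k).FreeUpTo k := by
  intro x g hg hx
  by_contra hne
  obtain ⟨M, hM0, hMl, hM⟩ := exists_coef_ne_zero hne
  have hex : {M : Monomial L k | coef g M.1 ≠ coef 1 M.1}.Nonempty :=
    ⟨⟨M, hM0, hMl.trans hg⟩, by simpa [coef_one, base, hM0] using hM⟩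
  obtain ⟨N, hN, hmin⟩ := WellFounded.has_min
    (InvImage.wf (fun M : Monomial L k => M.1.length) wellFounded_lt) _ hex
  have h := truncAction_sub (R := ZMod m) x (g := g) (h := 1) (M := N) fun N' hN' => by
    by_contra h
    exact hmin N' h hN'
  rw [hx, RightAction.act_one, sub_self, coef_one, base, if_neg N.2.1, sub_zero, eq_comm,
    ZMod.intCast_zmod_eq_zero_iff_dvd] at h
  apply hN
  rw [coef_one, base, if_neg N.2.1]
  refine Int.eq_zero_of_abs_lt_dvd h ((hC g hg N.1 N.2.2).trans_lt ?_)
  exact_mod_cast hm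

theorem exists_linearOrder_of_injective {α : Type u} {β : Type v} [LinearOrder β] (f : α → β)
    (hf : Function.Injective f) : ∃ o : LinearOrder α, ∀ a b, o.lt a b ↔ f a < f b :=
  ⟨LinearOrder.lift' f hf, fun _ _ => Iff.rfl⟩

omit [DecidableEq L] in
theorem exists_linearOrder_monomial [Finite L] (k : ℕ) :
    ∃ o : LinearOrder (Monomial L k), ∀ M N, M.1.length < N.1.length → o.lt M N := by
  have := finite_monomial (L := L) k
  obtain ⟨n, ⟨e⟩⟩ := Finite.exists_equiv_fin (Monomial L k)
  obtain ⟨o, ho⟩ := exists_linearOrder_of_injective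
    (fun M : Monomial L k => (toLex (M.1.length, e M) : ℕ ×ₗ Fin n))
    fun M N h => e.injective (congrArg Prod.snd (toLex_inj.1 h))
  exact ⟨o, fun M N h => (ho M N).2 (Prod.Lex.toLex_lt_toLex.2 (Or.inl h))⟩

/-! ### Comparison of the two lexicographic orders, and counting of the exceptions -/

section Order

variable {k : ℕ} [LinearOrder (Monomial L k)]

/-- At the first monomial where the words differ, passing from `x·g` to `x·h` adds a positive
integer at most `2 * C` to the coordinate; `hx` leaves room for it below `m`. Lower degrees come
first by `hI`, so earlier coordinates agree. -/
theorem lt_of_coef_lt {m C : ℕ} [NeZero m]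
    (hI : ∀ M N : Monomial L k, M.1.length < N.1.length → M < N)
    (hC : ∀ g : FreeGroup L, g.norm ≤ k → ∀ M : List L, M.length ≤ k → |coef g M| ≤ C)
    {g h : FreeGroup L} (hg : g.norm ≤ k) (hh : h.norm ≤ k) (x : Monomial L k → ZMod m)
    (hx : ∀ M, ((truncAction L (ZMod m) k).act x g M).val + 2 * C < m)
    (hlt : toLex (fun M : Monomial L k => coef g M.1) < toLex (fun M => coef h M.1)) :
    toLex (fun M => ((truncAction L (ZMod m) k).act x g M).val)
      < toLex (fun M => ((truncAction L (ZMod m) k).act x h M).val) := by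
  obtain ⟨M, hM, hlt⟩ := hlt
  have hM' : ∀ N < M, coef g N.1 = coef h N.1 := hM
  have hlt' : coef g M.1 < coef h M.1 := hlt
  have hsub : ∀ N ≤ M, (truncAction L (ZMod m) k).act x g N - (truncAction L (ZMod m) k).act x h N
      = ((coef g N.1 - coef h N.1 : ℤ) : ZMod m) := fun N hN =>
    truncAction_sub x fun N' hN' => hM' N' ((hI _ _ hN').trans_le hN)
  refine ⟨M, fun N hN => ?_, ?_⟩
  · have := hsub N hN.le
    rw [hM' N hN, sub_self, Int.cast_zero, sub_eq_zero] at this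
    exact congrArg ZMod.val this
  · show ((truncAction L (ZMod m) k).act x g M).val < ((truncAction L (ZMod m) k).act x h M).val
    have h1 := hsub M le_rfl
    have h2 := hx M
    have h3 := abs_le.1 (hC g hg M.1 M.2.2)
    have h4 := abs_le.1 (hC h hh M.1 M.2.2)
    set y := (truncAction L (ZMod m) k).act x g M
    set z := (truncAction L (ZMod m) k).act x h M
    obtain ⟨d, hd⟩ := Int.eq_ofNat_of_zero_le (sub_nonneg.2 hlt'.le)
    have hz : z = ((y.val + d : ℕ) : ZMod m) := by
      have : (d : ZMod m) = ((coef h M.1 - coef g M.1 : ℤ) : ZMod m) := by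
        rw [hd]; simp
      rw [Nat.cast_add, ZMod.natCast_zmod_val, this, ← neg_sub (coef g M.1), Int.cast_neg, ← h1]
      ring
    rw [hz, ZMod.val_cast_of_lt (by omega)]
    omega

end Order

/-- One coordinate is uniformly distributed; the injection exchanges `y i` with an arbitrary
residue. -/
theorem ncard_fiber_mul_le {ι : Type u} [DecidableEq ι] [Finite ι] {m : ℕ} [NeZero m] (i : ι)
    (B : Set (ZMod m)) :
    {y : ι → ZMod m | y i ∈ B}.ncard * m ≤ B.ncard * Nat.card (ι → ZMod m) := by
  rw [← Nat.card_coe_set_eq, ← Nat.card_coe_set_eq]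
  have hm : Nat.card {y : ι → ZMod m | y i ∈ B} * m
      = Nat.card ({y : ι → ZMod m | y i ∈ B} × ZMod m) := by
    rw [Nat.card_prod, Nat.card_zmod]
  rw [hm, ← Nat.card_prod]
  refine Nat.card_le_card_of_injective
    (fun p : {y : ι → ZMod m | y i ∈ B} × ZMod m =>
      ((⟨p.1.1 i, p.1.2⟩, Function.update p.1.1 i p.2) : B × (ι → ZMod m))) ?_
  rintro ⟨⟨y, hy⟩, v⟩ ⟨⟨y', hy'⟩, v'⟩ h
  simp only [Prod.mk.injEq, Subtype.mk.injEq] at h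
  obtain ⟨h1, h2⟩ := h
  have hv : v = v' := by simpa using congrFun h2 i
  have hyy : y = y' := by
    funext j
    by_cases hj : j = i
    · rw [hj, h1]
    · simpa [hj] using congrFun h2 j
  subst hv hyy
  rfl

theorem ncard_val_ge_le (m c : ℕ) [NeZero m] : {v : ZMod m | m ≤ v.val + c}.ncard ≤ c := by
  have h : {v : ZMod m | m ≤ v.val + c}.ncard ≤ (Finset.Ico (m - c) m : Set ℕ).ncard := by
    refine Set.ncard_le_ncard_of_injOn ZMod.val ?_ ((ZMod.val_injective m).injOn) (Set.toFinite _)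
    intro v hv
    have := v.val_lt
    simp at hv ⊢
    omega
  refine h.trans ?_
  rw [Set.ncard_coe_finset, Nat.card_Ico]
  omega

/-- A union bound over tree words `g` and monomials `M`: the coordinate of `x·g` at `M` lies among
the top `2 * C` residues for a proportion at most `2 * C / m` of the points `x`. -/
theorem exists_rightAction [Finite L] (r : ℕ) :
    ∃ oStar : LinearOrder (TreeVertex L r), ∀ ε : ℝ, 0 < ε →
      ∃ (W : Type u) (_ : Finite W) (_ : Nonempty W) (oW : LinearOrder W) (A : RightAction L W),
        A.FreeUpTo (2 * r + 2) ∧ LDigraph.HasFraction {x | A.IsOrderedAt oW oStar x} (1 - ε) := by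
  -- Balls and girth need `2 * r + 1`; the digraph itself needs freeness up to length 2, also when
  -- `r = 0`.
  set k := 2 * r + 2 with hk
  have hfI := finite_monomial (L := L) k
  have hfT := finite_treeVertex (L := L) r
  obtain ⟨oI, hI⟩ := exists_linearOrder_monomial (L := L) k
  obtain ⟨C, hC⟩ := exists_coef_bound (L := L) k
  obtain ⟨oStar, hoStar⟩ := exists_linearOrder_of_injective
    (fun g : TreeVertex L r => toLex (fun M : Monomial L k => coef g.1 M.1)) fun g h hgh => by
      have h1 := g.2
      have h2 := h.2
      exact Subtype.ext (eq_of_coef_eq (k := k) (by omega)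
        fun M hM0 hM => congrFun (toLex_inj.1 hgh) ⟨M, hM0, hM⟩)
  refine ⟨oStar, fun ε hε => ?_⟩
  obtain ⟨m₀, hm₀⟩ := exists_nat_gt
    ((Nat.card (TreeVertex L r × Monomial L k) : ℝ) * (2 * C) / ε)
  -- The term `m₀` makes the union bound at most `ε`, and `C + 1` gives freeness.
  set m := m₀ + C + 1 with hm
  have : NeZero m := ⟨by omega⟩
  set A := truncAction L (ZMod m) k with hA
  obtain ⟨oW, hoW⟩ := exists_linearOrder_of_injective
    (fun x : Monomial L k → ZMod m => toLex (fun M => (x M).val)) fun x y h =>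
      funext fun M => ZMod.val_injective m (congrFun (toLex_inj.1 h) M)
  refine ⟨Monomial L k → ZMod m, inferInstance, inferInstance, oW, A,
    truncAction_freeUpTo hC (by omega), ?_⟩
  have hsub : {x | A.IsOrderedAt oW oStar x}ᶜ ⊆ ⋃ p ∈ (Set.univ : Set (TreeVertex L r × Monomial L k)),
      {x | m ≤ (A.act x p.1.1 p.2).val + 2 * C} := by
    intro x hx
    by_contra hnot
    simp only [Set.mem_univ, Set.iUnion_true, Set.mem_iUnion, Set.mem_ofPred_eq, not_exists,
      not_le] at hnot
    apply hx
    -- One implication suffices, both orders being total.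
    have hmono : ∀ g h : TreeVertex L r, oStar.lt g h → oW.lt (A.act x g.1) (A.act x h.1) := by
      intro g h hgh
      have h1 := g.2
      have h2 := h.2
      exact (hoW _ _).2 (lt_of_coef_lt hI hC (by omega) (by omega) x (fun M => hnot (g, M))
        ((hoStar _ _).1 hgh))
    refine fun g h => ⟨hmono g h, fun hlt => ?_⟩
    rcases @lt_trichotomy _ oStar g h with h1 | h1 | h1
    · exact h1
    · subst h1
      exact absurd hlt (@lt_irrefl _ oW.toPreorder _)
    · exact absurd hlt (@lt_asymm _ oW.toPreorder _ _ (hmono _ _ h1))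
  have hcard : ∀ p : TreeVertex L r × Monomial L k,
      ({x | m ≤ (A.act x p.1.1 p.2).val + 2 * C}.ncard : ℝ) * m
        ≤ 2 * C * Nat.card (Monomial L k → ZMod m) := by
    intro p
    have h1 : {x | m ≤ (A.act x p.1.1 p.2).val + 2 * C}.ncard
        ≤ {y : Monomial L k → ZMod m | y p.2 ∈ {v : ZMod m | m ≤ v.val + 2 * C}}.ncard := by
      -- The word acts injectively, so its bad points may be counted through their images.
      refine Set.ncard_le_ncard_of_injOn (fun x => A.act x p.1.1) (fun x hx => hx) ?_
        (Set.toFinite _)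
      intro x _ y _ h
      rw [← A.act_mul_inv x p.1.1, ← A.act_mul_inv y p.1.1]
      exact congrArg (fun z => A.act z _) h
    have h2 := ncard_fiber_mul_le p.2 {v : ZMod m | m ≤ v.val + 2 * C}
    have h3 := ncard_val_ge_le m (2 * C)
    exact_mod_cast (Nat.mul_le_mul_right m h1).trans (h2.trans (Nat.mul_le_mul_right _ h3))
  set N := Nat.card (Monomial L k → ZMod m) with hN
  have hbad : ({x | A.IsOrderedAt oW oStar x}ᶜ.ncard : ℝ) * m
      ≤ Nat.card (TreeVertex L r × Monomial L k) * (2 * C * N) := by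
    have := Fintype.ofFinite (TreeVertex L r × Monomial L k)
    have h1 : {x | A.IsOrderedAt oW oStar x}ᶜ.ncard ≤ ∑ p : TreeVertex L r × Monomial L k,
        {x | m ≤ (A.act x p.1.1 p.2).val + 2 * C}.ncard := by
      refine (Set.ncard_le_ncard hsub (Set.toFinite _)).trans ?_
      have := Finset.set_ncard_biUnion_le (Finset.univ : Finset (TreeVertex L r × Monomial L k))
        fun p => {x | m ≤ (A.act x p.1.1 p.2).val + 2 * C}
      simpa using this
    calc ({x | A.IsOrderedAt oW oStar x}ᶜ.ncard : ℝ) * m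
        ≤ (∑ p : TreeVertex L r × Monomial L k,
          ({x | m ≤ (A.act x p.1.1 p.2).val + 2 * C}.ncard : ℝ)) * m := by
          gcongr
          exact_mod_cast h1
      _ ≤ ∑ p : TreeVertex L r × Monomial L k, (2 * C * N : ℝ) := by
          rw [Finset.sum_mul]
          exact Finset.sum_le_sum fun p _ => hcard p
      _ = _ := by simp [Nat.card_eq_fintype_card]
  have htot := Set.ncard_add_ncard_compl {x | A.IsOrderedAt oW oStar x}
  have htot' : ({x | A.IsOrderedAt oW oStar x}.ncard : ℝ)
      + {x | A.IsOrderedAt oW oStar x}ᶜ.ncard = N := by exact_mod_cast htot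
  have hmpos : (0 : ℝ) < m := by exact_mod_cast Nat.pos_of_ne_zero (NeZero.ne m)
  have hmε : (Nat.card (TreeVertex L r × Monomial L k) : ℝ) * (2 * C) ≤ ε * m := by
    rw [div_lt_iff₀ hε] at hm₀
    have : (m₀ : ℝ) ≤ m := by exact_mod_cast (by omega : m₀ ≤ m)
    nlinarith
  have : ({x | A.IsOrderedAt oW oStar x}ᶜ.ncard : ℝ) ≤ ε * N := by
    refine le_of_mul_le_mul_right (hbad.trans ?_) hmpos
    have hN0 : (0 : ℝ) ≤ N := Nat.cast_nonneg _
    nlinarith [mul_le_mul_of_nonneg_right hmε hN0]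
  rw [LDigraph.HasFraction]
  linarith

end Magnus

/-! ### Densities, fibres and connected components -/

namespace LDigraph

theorem HasFraction.mono {V : Type v} [Finite V] {U U' : Set V} {c : ℝ} (h : HasFraction U c)
    (hU : U ⊆ U') : HasFraction U' c :=
  le_trans h (by exact_mod_cast Set.ncard_le_ncard hU (Set.toFinite _))

theorem HasFraction.of_equiv {V : Type v} {W : Type w} {U : Set V} {U' : Set W} {c : ℝ}
    (h : HasFraction U c) (e : W ≃ V) (hU : ∀ x, e x ∈ U → x ∈ U') [Finite W] :
    HasFraction U' c := by
  have h1 : (e ⁻¹' U).ncard = U.ncard := by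
    rw [Set.ncard_preimage_of_injective_subset_range e.injective]
    simp
  have h2 : HasFraction (e ⁻¹' U) c := by
    rw [HasFraction, h1, Nat.card_congr e]
    exact h
  exact h2.mono hU

theorem HasFraction.fst {W : Type w} (V : Type v) {U : Set W} {c : ℝ} (h : HasFraction U c) :
    HasFraction {p : W × V | p.1 ∈ U} c := by
  have h1 : {p : W × V | p.1 ∈ U} = U ×ˢ Set.univ := by
    ext p
    simp
  rw [HasFraction, h1, Set.ncard_prod, Nat.card_prod, Set.ncard_univ, Nat.cast_mul, Nat.cast_mul,
    ← mul_assoc]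
  exact mul_le_mul_of_nonneg_right h (Nat.cast_nonneg _)

/-- Averaging: a set which contains a fraction `c` of all elements contains a fraction `c` of the
elements of some fibre of `f`. -/
theorem HasFraction.exists_fiber {V : Type v} {W : Type w} [Finite V] [Nonempty V] {U : Set V}
    {c : ℝ} (h : HasFraction U c) (f : V → W) :
    ∃ x₀, ∀ S : Set V, (∀ x, x ∈ S ↔ f x = f x₀) → HasFraction {x : S | x.1 ∈ U} c := by
  classical
  have := Fintype.ofFinite V
  -- The sum of `φ` over a set is nonnegative exactly when `U` has density at least `c` there.
  let φ : V → ℝ := fun x => (if x ∈ U then 1 else 0) - c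
  have hcard : ∀ T : Finset V, ∑ x ∈ T, φ x = ((T.filter (· ∈ U)).card : ℝ) - c * T.card := by
    intro T
    simp only [φ, Finset.sum_sub_distrib, Finset.sum_boole, Finset.sum_const, nsmul_eq_mul]
    ring
  have h0 : 0 ≤ ∑ x, φ x := by
    rw [hcard, sub_nonneg]
    have h1 : (Finset.univ.filter (· ∈ U)).card = U.ncard := by
      rw [← Set.ncard_coe_finset]
      simp
    rw [h1, Finset.card_univ, ← Nat.card_eq_fintype_card]
    exact h
  rw [← Finset.sum_fiberwise_of_maps_to (t := Finset.univ.image f) (g := f)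
    (fun x _ => Finset.mem_image_of_mem f (Finset.mem_univ x))] at h0
  obtain ⟨b, hb, hle⟩ := Finset.exists_le_of_sum_le (f := fun _ => (0 : ℝ))
    (Finset.univ_nonempty.image f) (by simpa using h0)
  obtain ⟨x₀, -, rfl⟩ := Finset.mem_image.1 hb
  refine ⟨x₀, fun S hS => ?_⟩
  rw [hcard, sub_nonneg] at hle
  set T := Finset.univ.filter fun x => f x = f x₀ with hT
  have hST : S = T := by
    ext x
    simp [hT, hS]
  have h1 : Nat.card S = T.card := by
    rw [hST, Nat.card_coe_set_eq, Set.ncard_coe_finset]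
  have h2 : {x : S | x.1 ∈ U}.ncard = (T.filter (· ∈ U)).card := by
    rw [← Set.ncard_image_of_injective _ Subtype.val_injective, ← Set.ncard_coe_finset]
    congr 1
    ext x
    simp [hST, and_comm]
  rw [HasFraction, h1, h2]
  exact hle

variable {L : Type u} {V : Type v}

theorem induce_toSimpleGraph (G : LDigraph L V) (S : Set V) :
    (G.induce S).toSimpleGraph = G.toSimpleGraph.induce S := by
  ext x y
  simp [toSimpleGraph, induce, SimpleGraph.fromRel_adj, Subtype.ext_iff]

theorem induce_supp_connected (G : LDigraph L V) (K : G.toSimpleGraph.ConnectedComponent) :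
    (G.induce K.supp).Connected := by
  rw [Connected, induce_toSimpleGraph]
  exact K.connected_toSimpleGraph

theorem Step.mem_supp {G : LDigraph L V} {K : G.toSimpleGraph.ConnectedComponent} {x y : V}
    {e : L × Bool} (h : G.Step e x y) (hx : x ∈ K.supp) : y ∈ K.supp := by
  rw [SimpleGraph.ConnectedComponent.mem_supp_iff] at hx ⊢
  rw [← hx, SimpleGraph.ConnectedComponent.eq]
  exact (SimpleGraph.reachable_of_edist_ne_top
    (ne_top_of_le_ne_top ENat.one_ne_top h.edist_le)).symm

theorem induce_supp_outDegree (G : LDigraph L V) (K : G.toSimpleGraph.ConnectedComponent)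
    (x : K.supp) : (G.induce K.supp).outDegree x = G.outDegree x := by
  rw [outDegree, outDegree, ← Set.ncard_image_of_injective _ Subtype.val_injective]
  congr 1
  ext y
  constructor
  · rintro ⟨y, ⟨a, h⟩, rfl⟩
    exact ⟨a, h⟩
  · rintro ⟨a, h⟩
    exact ⟨⟨y, Step.mem_supp (e := (a, true)) h x.2⟩, ⟨a, h⟩, rfl⟩

theorem induce_supp_inDegree (G : LDigraph L V) (K : G.toSimpleGraph.ConnectedComponent)
    (x : K.supp) : (G.induce K.supp).inDegree x = G.inDegree x := by
  rw [inDegree, inDegree, ← Set.ncard_image_of_injective _ Subtype.val_injective]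
  congr 1
  ext y
  constructor
  · rintro ⟨y, ⟨a, h⟩, rfl⟩
    exact ⟨a, h⟩
  · rintro ⟨a, h⟩
    exact ⟨⟨y, Step.mem_supp (e := (a, false)) h x.2⟩, ⟨a, h⟩, rfl⟩

/-- There is a linear order on `V` which refines the pull-back of a linear order along `π`. -/
theorem exists_linearOrder_pullback {V : Type v} {W : Type w} (oW : LinearOrder W) (π : V → W) :
    ∃ o : LinearOrder V, ∀ y z, π y ≠ π z → (o.lt y z ↔ oW.lt (π y) (π z)) := by
  classical
  let oV : LinearOrder V := linearOrderOfSTO (WellOrderingRel (α := V))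
  let e : V → W ×ₗ V := fun y => toLex (π y, y)
  have he : Function.Injective e := fun y z h => congrArg Prod.snd (toLex_inj.1 h)
  refine ⟨LinearOrder.lift' e he, fun y z hne => ?_⟩
  refine (Prod.Lex.toLex_lt_toLex (x := (π y, y)) (y := (π z, z))).trans ?_
  exact ⟨fun h => h.resolve_right fun h => hne h.1, Or.inl⟩

end LDigraph

/-! ### Restriction to an orbit -/

namespace FreeGroup.RightAction

variable {L : Type u} {W : Type w}

/-- The restriction of an action to (an injective image of) an invariant set. -/
noncomputable def pullback {X : Type v} (A : RightAction L W) (e : X → W)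
    (he : Function.Injective e) (h : ∀ x g, ∃ y, e y = A.act (e x) g) : RightAction L X where
  act x g := (h x g).choose
  act_one x := he (by rw [(h x 1).choose_spec, A.act_one])
  act_mul x g g' := he (by
    rw [(h x (g * g')).choose_spec, (h _ g').choose_spec, (h x g).choose_spec, A.act_mul])

section
variable {X : Type v} {A : RightAction L W} {e : X → W} {he : Function.Injective e}
  {h : ∀ x g, ∃ y, e y = A.act (e x) g}

theorem pullback_act (x : X) (g : FreeGroup L) :
    e ((A.pullback e he h).act x g) = A.act (e x) g :=
  (h x g).choose_spec

theorem FreeUpTo.pullback [DecidableEq L] {n : ℕ} (hA : A.FreeUpTo n) :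
    (A.pullback e he h).FreeUpTo n := fun x g hg hx => by
  refine hA (e x) g hg ?_
  rw [← pullback_act (he := he) (h := h), hx]

end

/-- Passing to a suitable orbit, and to the type `Fin n`. -/
theorem exists_transitive [DecidableEq L] [Finite W] [Nonempty W] {r n : ℕ} {oW : LinearOrder W}
    {oStar : LinearOrder (TreeVertex L r)} {c : ℝ} {A : RightAction L W} (hA : A.FreeUpTo n)
    (hc : LDigraph.HasFraction {x | A.IsOrderedAt oW oStar x} c) :
    ∃ (X : Type) (_ : Finite X) (_ : Nonempty X) (oX : LinearOrder X) (A' : RightAction L X),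
      A'.FreeUpTo n ∧ A'.Transitive ∧ LDigraph.HasFraction {x | A'.IsOrderedAt oX oStar x} c := by
  obtain ⟨x₀, hx₀⟩ := hc.exists_fiber fun x => {y | ∃ g, A.act x g = y}
  set S : Set W := {y | ∃ g, A.act x₀ g = y} with hS
  have hfrac := hx₀ S fun x => by
    constructor
    · rintro ⟨g, rfl⟩
      ext y
      constructor
      · rintro ⟨g', rfl⟩
        exact ⟨g * g', A.act_mul _ _ _⟩
      · rintro ⟨g', rfl⟩
        exact ⟨g⁻¹ * g', by rw [A.act_mul, A.act_mul_inv]⟩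
    · intro h
      have : x ∈ {y | ∃ g, A.act x g = y} := ⟨1, A.act_one x⟩
      exact h ▸ this
  obtain ⟨N, ⟨i⟩⟩ := Finite.exists_equiv_fin S
  let e : Fin N → W := fun j => (i.symm j).1
  have he : Function.Injective e := Subtype.val_injective.comp i.symm.injective
  have h : ∀ x g, ∃ y, e y = A.act (e x) g := by
    intro x g
    obtain ⟨g', hg'⟩ := (i.symm x).2
    refine ⟨i ⟨A.act (e x) g, g' * g, ?_⟩, by simp [e]⟩
    rw [A.act_mul, hg']
  obtain ⟨oX, hoX⟩ := Magnus.exists_linearOrder_of_injective e he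
  refine ⟨Fin N, inferInstance, ⟨i ⟨x₀, 1, A.act_one x₀⟩⟩, oX, A.pullback e he h, hA.pullback,
    ?_, ?_⟩
  · intro x y
    obtain ⟨g, hg⟩ := (i.symm x).2
    obtain ⟨g', hg'⟩ := (i.symm y).2
    refine ⟨g⁻¹ * g', he ?_⟩
    refine (pullback_act x _).trans ?_
    show A.act (i.symm x).1 _ = (i.symm y).1
    rw [← hg, ← hg', A.act_mul, A.act_mul_inv]
  · refine hfrac.of_equiv i.symm fun x hx g g' => ?_
    refine (hx g g').trans (Iff.symm ((hoX _ _).trans ?_))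
    have h1 := pullback_act (he := he) (h := h) x g.1
    have h2 := pullback_act (he := he) (h := h) x g'.1
    exact h1 ▸ h2 ▸ Iff.rfl

/-! ### Products with a Schreier digraph as lifts -/

section Product

variable [DecidableEq L] {A : RightAction L W} {hA2 : A.FreeUpTo 2} {V : Type v} {r : ℕ}

theorem product_isHom (G : LDigraph L V) : A.IsHom ((A.digraph hA2).product G) Prod.fst :=
  fun _ _ _ h => h.1

theorem product_trace {G : LDigraph L V} (x : W) {l : List (L × Bool)} {g g' : V}
    (h : G.Trace l g g') :
    ((A.digraph hA2).product G).Trace l (x, g) (A.act x (FreeGroup.mk l), g') := by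
  induction l generalizing x g with
  | nil =>
    obtain rfl : g = g' := h
    exact Prod.ext (A.act_one x).symm rfl
  | cons e l ih =>
    obtain ⟨t, ht, h⟩ := h
    have hm : (FreeGroup.mk (e :: l) : FreeGroup L) = FreeGroup.mk [e] * FreeGroup.mk l := by
      rw [FreeGroup.mul_mk]; rfl
    rw [hm, A.act_mul]
    refine ⟨(A.act x (FreeGroup.mk [e]), t), ?_, ih _ h⟩
    have hs := digraph_step (hA2 := hA2) x e
    obtain ⟨a, _ | _⟩ := e
    · exact ⟨hs, ht⟩
    · exact ⟨hs, ht⟩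

/-- Every label enters and leaves each vertex of the Schreier digraph exactly once, so an edge of
`G` lifts uniquely at each vertex above either end. -/
theorem product_isCoveringMap [Nonempty W] (G : LDigraph L V) :
    LDigraph.IsCoveringMap ((A.digraph hA2).product G) G Prod.snd where
  surjective := Prod.snd_surjective
  map_edge _ _ _ h := h.2
  outDegree_eq x := by
    rw [LDigraph.outDegree, LDigraph.outDegree, ← Set.InjOn.ncard_image (f := Prod.snd)]
    · congr 1
      ext y
      constructor
      · rintro ⟨y, ⟨a, h⟩, rfl⟩
        exact ⟨a, h.2⟩
      · rintro ⟨a, h⟩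
        exact ⟨(_, y), ⟨a, digraph_step (hA2 := hA2) x.1 (a, true), h⟩, rfl⟩
    · rintro ⟨w, y⟩ ⟨a, h⟩ ⟨w', y'⟩ ⟨b, h'⟩ (rfl : y = y')
      obtain rfl : a = b := G.label_unique _ _ _ _ h.2 h'.2
      exact Prod.ext ((A.digraph hA2).out_proper _ _ _ _ h.1 h'.1) rfl
  inDegree_eq x := by
    rw [LDigraph.inDegree, LDigraph.inDegree, ← Set.InjOn.ncard_image (f := Prod.snd)]
    · congr 1
      ext y
      constructor
      · rintro ⟨y, ⟨a, h⟩, rfl⟩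
        exact ⟨a, h.2⟩
      · rintro ⟨a, h⟩
        exact ⟨(_, y), ⟨a, digraph_step (hA2 := hA2) x.1 (a, false), h⟩, rfl⟩
    · rintro ⟨w, y⟩ ⟨a, h⟩ ⟨w', y'⟩ ⟨b, h'⟩ (rfl : y = y')
      obtain rfl : a = b := G.label_unique _ _ _ _ h.2 h'.2
      exact Prod.ext ((A.digraph hA2).in_proper _ _ _ _ h.1 h'.1) rfl

/-- Degrees are unchanged in a component. For surjectivity, a walk in `G` lifts from any vertex
above its start and stays in the component. -/
theorem component_isCoveringMap [Nonempty W] {G : LDigraph L V} (hG : G.Connected)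
    (K : ((A.digraph hA2).product G).toSimpleGraph.ConnectedComponent) :
    LDigraph.IsCoveringMap (((A.digraph hA2).product G).induce K.supp) G (fun x => x.1.2) where
  surjective g := by
    obtain ⟨⟨x, g₀⟩, hx⟩ := K.nonempty_supp
    obtain ⟨p⟩ := hG.preconnected g₀ g
    obtain ⟨l, -, hl⟩ := LDigraph.exists_trace_of_walk p
    have ht := (product_trace (hA2 := hA2) x hl).edist_le
    have hr := SimpleGraph.reachable_of_edist_ne_top
      (ne_top_of_le_ne_top (ENat.natCast_ne_top _) ht)
    refine ⟨⟨(A.act x (FreeGroup.mk l), g), ?_⟩, rfl⟩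
    · rw [SimpleGraph.ConnectedComponent.mem_supp_iff] at hx ⊢
      rw [← hx, SimpleGraph.ConnectedComponent.eq]
      exact hr.symm
  map_edge _ _ _ h := h.2
  outDegree_eq x := by
    rw [LDigraph.induce_supp_outDegree]
    exact (product_isCoveringMap G).outDegree_eq x.1
  inDegree_eq x := by
    rw [LDigraph.induce_supp_inDegree]
    exact (product_isCoveringMap G).inDegree_eq x.1

end Product

end FreeGroup.RightAction

/-! ### The main theorem -/

theorem theorem4 {L : Type u} [Finite L] [DecidableEq L] (r : ℕ) :
    ∃ oStar : LinearOrder (TreeVertex L r), ∀ ε : ℝ, 0 < ε →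
      ∃ (W : Type) (_ : Finite W) (H : LDigraph L W) (oH : LinearOrder W),
        H.IsHomogeneous oH oStar ε ∧
        ∀ (V : Type v) [Finite V] (G : LDigraph L V),
          (∃ oC : LinearOrder (W × V),
            LDigraph.IsCoveringMap (H.product G) G Prod.snd ∧
            LDigraph.HasFraction ((H.product G).subtreeVertices oC oStar) (1 - ε)) ∧
          (G.Connected →
            ∃ (K : (H.product G).toSimpleGraph.ConnectedComponent) (oC : LinearOrder K.supp),
              ((H.product G).induce K.supp).Connected ∧
              LDigraph.IsCoveringMap ((H.product G).induce K.supp) G (fun x => x.1.2) ∧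
              LDigraph.HasFraction
                (((H.product G).induce K.supp).subtreeVertices oC oStar) (1 - ε)) := by
  obtain ⟨oStar, hStar⟩ := Magnus.exists_rightAction (L := L) r
  refine ⟨oStar, fun ε hε => ?_⟩
  obtain ⟨W₀, _, _, oW₀, A₀, hA₀, hfrac₀⟩ := hStar ε hε
  obtain ⟨W, hW, _, oW, A, hA, hT, hfrac⟩ := FreeGroup.RightAction.exists_transitive hA₀ hfrac₀
  have hA2 : A.FreeUpTo 2 := hA.mono (by omega)
  have hA1 : A.FreeUpTo (2 * r + 1) := hA.mono (by omega)
  refine ⟨W, hW, A.digraph hA2, oW, ⟨FreeGroup.RightAction.digraph_connected hT,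
    FreeGroup.RightAction.digraph_isOriented, FreeGroup.RightAction.digraph_isRegular,
    FreeGroup.RightAction.lt_egirth hA1,
    hfrac.mono fun x hx => FreeGroup.RightAction.mem_typeVertices hA1 hx⟩, fun V _ G => ⟨?_, ?_⟩⟩
  · obtain ⟨oC, hoC⟩ := LDigraph.exists_linearOrder_pullback oW (Prod.fst : W × V → W)
    exact ⟨oC, FreeGroup.RightAction.product_isCoveringMap G, (hfrac.fst V).mono fun x hx =>
      (FreeGroup.RightAction.product_isHom G).mem_subtreeVertices hA1 hoC hx⟩
  · intro hG
    have : Nonempty V := hG.nonempty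
    -- Good vertices are dense in the whole product, hence in at least one of its components.
    obtain ⟨x₀, hx₀⟩ := (hfrac.fst V).exists_fiber
      ((A.digraph hA2).product G).toSimpleGraph.connectedComponentMk
    let K := ((A.digraph hA2).product G).toSimpleGraph.connectedComponentMk x₀
    obtain ⟨oC, hoC⟩ := LDigraph.exists_linearOrder_pullback oW (fun x : K.supp => x.1.1)
    refine ⟨K, oC, LDigraph.induce_supp_connected _ K,
      FreeGroup.RightAction.component_isCoveringMap hG K,
      (hx₀ K.supp fun x => Iff.rfl).mono fun x hx => ?_⟩
    have hom : A.IsHom (((A.digraph hA2).product G).induce K.supp) (fun x => x.1.1) :=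
      fun _ _ _ h => h.1
    exact hom.mem_subtreeVertices hA1 hoC hx
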